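/- Throughout, a \emph{measure} on $\mathbb{R}^n$ is a complex, locally finite Borel measure $\mu$ which is slowly increasing, i.e. for some $N$ its total variation satisfies $|\mu|(\{x:|x|<R\})=O(R^N)$ as $R\to\infty$; it defines the temperate distribution $\varphi\mapsto\int\varphi\,d\mu$. The Fourier transform of a temperate distribution $\alpha$ is $\langle\hat\alpha,\varphi\rangle=\langle\alpha,\hat\varphi\rangle$, with $\hat\varphi(t)=\int\varphi(x)e^{-2\pi i\langle t,x\rangle}\,dx$. The support of a purely atomic measure is the set of its non-zero atoms. A set $A\subset\mathbb{R}^n$ is uniformly discrete if there is $\delta>0$ such that $|x-y|\ge\delta$ for all distinct $x,y\in A$. \textbf{Theorem.} Let $\mu$ be a purely atomic measure on $\mathbb{R}^n$ whose support $\Lambda$ is uniformly discrete, and assume that its Fourier transform $\hat\mu$ is a (slowly increasing) measure. Let $\hat\mu_d=\sum_{s}\hat\mu(\{s\})\,\delta_s$ be the discrete part of $\hat\mu$, where the sum is over all atoms $s$ of $\hat\mu$. Then there is a purely atomic measure $\mu'$ on $\mathbb{R}^n$ such that: \begin{itemize} \item $\hat\mu_d$ is the Fourier transform of $\mu'$;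 \item $\mu'$ is a weak limit of translates of $\mu$: there are $\tau_j\in\mathbb{R}^n$ $(j\in\mathbb{N})$ such that the measures $\mu(\,\cdot+\tau_j)$ converge to $\mu'$ in the space of temperate distributions, i.e. when tested on any Schwartz function; \item the support $\Lambda'$ of $\mu'$ is uniformly discrete; \item if $\Lambda-\Lambda$ is uniformly discrete, then $\Lambda'-\Lambda'$ is also uniformly discrete. \end{itemize} -/

import Mathlib

open MeasureTheory
open scoped Pointwise SchwartzMap FourierTransform ENNReal Topology

noncomputable section

/-- Euclidean space `ℝⁿ`. -/
abbrev Eucl (n : ℕ) : Type := EuclideanSpace ℝ (Fin n)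

/-- A positive Borel measure `m` on `ℝⁿ` is slowly increasing if `m (B_R) = O(R ^ N)` as `R → ∞`
for some `N`.  (The values `m (B_R)` are then all finite, so that the bound may be asked
for all `R ≥ 1`.) -/
def IsSlowlyIncreasing {n : ℕ} (m : Measure (Eucl n)) : Prop :=
  ∃ N : ℕ, ∃ C : ℝ, ∀ R : ℝ, 1 ≤ R → m (Metric.ball 0 R) ≤ ENNReal.ofReal (C * R ^ N)

theorem IsSlowlyIncreasing.mono {n : ℕ} {m m' : Measure (Eucl n)} (h : IsSlowlyIncreasing m)
    (hle : m' ≤ m) : IsSlowlyIncreasing m' := by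
  obtain ⟨N, C, hC⟩ := h
  exact ⟨N, C, fun R hR => (hle _).trans (hC R hR)⟩

theorem IsSlowlyIncreasing.map_sub {n : ℕ} {m : Measure (Eucl n)} (h : IsSlowlyIncreasing m)
    (τ : Eucl n) : IsSlowlyIncreasing (m.map (fun y => y - τ)) := by
  obtain ⟨N, C, hC⟩ := h
  refine ⟨N, |C| * (1 + ‖τ‖) ^ N, fun R hR => ?_⟩
  rw [Measure.map_apply (by fun_prop) Metric.isOpen_ball.measurableSet]
  have hsub : (fun y => y - τ) ⁻¹' Metric.ball (0 : Eucl n) R ⊆ Metric.ball 0 (R * (1 + ‖τ‖)) := by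
    intro y hy
    simp only [Set.mem_preimage, mem_ball_zero_iff] at hy ⊢
    have h1 : ‖y‖ ≤ ‖y - τ‖ + ‖τ‖ := by
      simpa using norm_add_le (y - τ) τ
    nlinarith [norm_nonneg τ]
  refine (measure_mono hsub).trans ((hC _ ?_).trans (ENNReal.ofReal_le_ofReal ?_))
  · nlinarith [norm_nonneg τ]
  · rw [mul_pow, mul_assoc, mul_comm (R ^ N)]
    exact mul_le_mul_of_nonneg_right (le_abs_self C) (by positivity)

theorem IsSlowlyIncreasing.hasTemperateGrowth {n : ℕ} {m : Measure (Eucl n)}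
    (h : IsSlowlyIncreasing m) : m.HasTemperateGrowth := by
  obtain ⟨N, C, hC⟩ := h
  refine ⟨⟨N + 2, ?_, ?_⟩⟩
  · have : Measurable fun x : Eucl n => (1 + ‖x‖) ^ (-((N + 2 : ℕ) : ℝ)) := by fun_prop
    exact this.aestronglyMeasurable
  · rw [hasFiniteIntegral_iff_enorm]
    have hpt : ∀ x : Eucl n, ‖(1 + ‖x‖) ^ (-((N + 2 : ℕ) : ℝ))‖ₑ ≤
        ∑' k : ℕ, (Metric.ball (0 : Eucl n) (k + 1)).indicator
          (fun _ => ENNReal.ofReal (((k : ℝ) + 1) ^ (N + 2))⁻¹) x := by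
      intro x
      refine le_trans ?_ (ENNReal.le_tsum ⌊‖x‖⌋₊)
      rw [Set.indicator_of_mem (by simpa using Nat.lt_floor_add_one ‖x‖),
        Real.enorm_of_nonneg (by positivity), Real.rpow_neg (by positivity), Real.rpow_natCast]
      refine ENNReal.ofReal_le_ofReal (inv_anti₀ (by positivity) ?_)
      have := Nat.floor_le (norm_nonneg x)
      gcongr ?_ ^ _
      linarith
    refine (lintegral_mono hpt).trans_lt ?_
    rw [lintegral_tsum fun k =>
      (measurable_const.indicator Metric.isOpen_ball.measurableSet).aemeasurable]
    have hterm : ∀ k : ℕ, ∫⁻ x, (Metric.ball (0 : Eucl n) (k + 1)).indicator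
        (fun _ => ENNReal.ofReal (((k : ℝ) + 1) ^ (N + 2))⁻¹) x ∂m ≤
        ENNReal.ofReal (|C| * (1 / ((k + 1 : ℕ) : ℝ) ^ 2)) := by
      intro k
      rw [lintegral_indicator_const Metric.isOpen_ball.measurableSet]
      refine (mul_le_mul_right (hC _ (by simp)) _).trans ?_
      rw [← ENNReal.ofReal_mul (by positivity)]
      refine ENNReal.ofReal_le_ofReal ?_
      have hk : (0 : ℝ) < (k : ℝ) + 1 := by positivity
      calc (((k : ℝ) + 1) ^ (N + 2))⁻¹ * (C * ((k : ℝ) + 1) ^ N)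
          ≤ (((k : ℝ) + 1) ^ (N + 2))⁻¹ * (|C| * ((k : ℝ) + 1) ^ N) := by
            gcongr; exact le_abs_self C
        _ = |C| * (1 / ((k + 1 : ℕ) : ℝ) ^ 2) := by
            push_cast; field_simp; ring
    refine (ENNReal.tsum_le_tsum hterm).trans_lt ?_
    have hs : Summable fun k : ℕ => |C| * (1 / ((k + 1 : ℕ) : ℝ) ^ 2) :=
      ((summable_nat_add_iff 1).2 (Real.summable_one_div_nat_pow.2 one_lt_two)).mul_left _
    rw [← ENNReal.ofReal_tsum_of_nonneg (fun k => by positivity) hs]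
    exact ENNReal.ofReal_lt_top

/-- A slowly increasing complex (locally finite, in general infinite) Borel measure on `ℝⁿ`,
given by its polar decomposition `μ = phase · |μ|`: a slowly increasing positive measure `|μ|`, the
total variation, and a measurable density of modulus one.  The value of `μ` on a bounded Borel
set `A` is `∫_A phase d|μ|`, see `SIMeasure.mass`. -/
structure SIMeasure (n : ℕ) where
  /-- The total variation measure `|μ|`. -/
  variation : Measure (Eucl n)
  /-- The density of `μ` with respect to `|μ|`. -/
  phase : Eucl n → ℂ
  measurable_phase : Measurable phase
  norm_phase : ∀ x, ‖phase x‖ = 1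
  slowlyIncreasing : IsSlowlyIncreasing variation

namespace SIMeasure

variable {n : ℕ}

/-- The value `μ(A)` on a bounded Borel set `A`. -/
def mass (μ : SIMeasure n) (A : Set (Eucl n)) : ℂ :=
  ∫ x in A, μ.phase x ∂μ.variation

/-- The set of points `x` with `μ({x}) ≠ 0`; for a pure point measure this is its support. -/
def atoms (μ : SIMeasure n) : Set (Eucl n) :=
  {x | μ.mass {x} ≠ 0}

/-- `μ` is a pure point (purely atomic) measure: it is carried by the set of its atoms. -/
def IsPurePoint (μ : SIMeasure n) : Prop :=
  μ.variation μ.atomsᶜ = 0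

/-- The discrete (pure point) part `μ_d = ∑ μ({s}) δ_s`, that is the restriction of `μ` to the
(countable) set of its atoms. -/
def discretePart (μ : SIMeasure n) : SIMeasure n where
  variation := μ.variation.restrict μ.atoms
  phase := μ.phase
  measurable_phase := μ.measurable_phase
  norm_phase := μ.norm_phase
  slowlyIncreasing := μ.slowlyIncreasing.mono Measure.restrict_le_self

/-- The translate `A ↦ μ(A + τ)` of `μ`, formally `μ(t + τ)`. -/
def translate (μ : SIMeasure n) (τ : Eucl n) : SIMeasure n where
  variation := μ.variation.map (fun y => y - τ)
  phase := fun x => μ.phase (x + τ)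
  measurable_phase := μ.measurable_phase.comp (by fun_prop)
  norm_phase := fun x => μ.norm_phase (x + τ)
  slowlyIncreasing := μ.slowlyIncreasing.map_sub τ

theorem memLp_phase (μ : SIMeasure n) : MemLp μ.phase ∞ μ.variation :=
  memLp_top_of_bound μ.measurable_phase.aestronglyMeasurable 1
    (Filter.Eventually.of_forall fun x => (μ.norm_phase x).le)

/-- The temperate distribution `φ ↦ ∫ φ dμ` defined by `μ`. -/
def toDistribution (μ : SIMeasure n) : 𝓢'(Eucl n, ℂ) :=
  haveI := μ.slowlyIncreasing.hasTemperateGrowth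
  Lp.toTemperedDistribution (μ.memLp_phase.toLp μ.phase)

theorem toDistribution_apply (μ : SIMeasure n) (φ : 𝓢(Eucl n, ℂ)) :
    μ.toDistribution φ = ∫ x, φ x * μ.phase x ∂μ.variation := by
  have := μ.slowlyIncreasing.hasTemperateGrowth
  rw [toDistribution, Lp.toTemperedDistribution_apply]
  refine integral_congr_ae ?_
  filter_upwards [μ.memLp_phase.coeFn_toLp] with x hx
  rw [hx, smul_eq_mul]

end SIMeasure

/-- A set is uniformly discrete if the distances between its distinct points are bounded below
by a positive constant. -/
def IsUniformlyDiscrete {n : ℕ} (A : Set (Eucl n)) : Prop :=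
  ∃ δ : ℝ, 0 < δ ∧ ∀ x ∈ A, ∀ y ∈ A, x ≠ y → δ ≤ dist x y

end

/-!
The average of `‖𝓕 (g m) (c z)‖²` over a Gaussian variable `z` is a double integral which, as
`c → ∞`, concentrates on the diagonal, a null set when `m` has no atoms (Wiener). Hence the Fourier
transforms of finitely many measures `g m` are simultaneously small at suitable frequencies.
If all differences of a sequence of frequencies are of this kind, recurrence in a
compact group makes the characters of one such difference close to `1` on finitely many given
points as well. So along some sequence `t j` the characters tend to `1` at each atom of `ν`, while
the Fourier transforms of the continuous part of `ν` tend to `0`: the translates of `μ` by `-t j`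
converge to the inverse Fourier transform of the discrete part of `ν`.

Testing `μ` against translates of a bump function bounds its masses. Hence the translates are pure
point measures with bounded masses and uniformly separated atoms. Labelling their atoms by a fine
lattice, one takes limits of masses and positions along an ultrafilter; they define a pure point
measure whose atoms are limits of atoms of the translates, so that separation is inherited.
-/

section

open Filter ProbabilityTheory
open scoped ComplexConjugate RealInnerProductSpace

local notation "𝓕[" m "]" => VectorFourier.fourierIntegral 𝐞 m (innerₗ _)

theorem measure_prod_diagonal {α : Type*} [MeasurableSpace α] [MeasurableEq α]
    (m m' : Measure α) [SFinite m'] [NullSingletonClass m'] :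
    m.prod m' (Set.diagonal α) = 0 := by
  rw [Measure.measure_prod_null measurableSet_diagonal]
  refine Eventually.of_forall fun x => ?_
  have hfiber : Prod.mk x ⁻¹' Set.diagonal α = {x} := by
    ext y
    simp [eq_comm]
  simp [hfiber]

theorem integrable_mul_conj_prod {α : Type*} [MeasurableSpace α] {m : Measure α}
    {g : α → ℂ} (hg : Integrable g m) :
    Integrable (fun p : α × α => g p.1 * conj (g p.2)) (m.prod m) :=
  hg.mul_prod (Complex.conjCLE.toContinuousLinearMap.integrable_comp hg)

theorem exists_lt_div_mem_of_compactSpace {G : Type*} [Group G] [TopologicalSpace G]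
    [IsTopologicalGroup G] [CompactSpace G] (σ : ℕ → G) {U : Set G} (hU : U ∈ 𝓝 1) :
    ∃ i j, i < j ∧ σ j / σ i ∈ U := by
  obtain ⟨x, hx⟩ := exists_clusterPt_of_compactSpace (map σ atTop)
  have hdiv : Tendsto (fun p : G × G => p.1 / p.2) (𝓝 x ×ˢ 𝓝 x) (𝓝 1) := by
    simpa [nhds_prod_eq] using (continuous_div'.tendsto (x, x))
  obtain ⟨V, hV, hVU⟩ := mem_prod_same_iff.1 (hdiv hU)
  have hfreq : ∃ᶠ i in atTop, σ i ∈ V := MapClusterPt.frequently hx hV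
  obtain ⟨i, hi⟩ := hfreq.exists
  obtain ⟨j, hij, hj⟩ := (hfreq.and_eventually (eventually_gt_atTop i)).exists
  exact ⟨i, j, hj, hVU (Set.mk_mem_prod hij hi)⟩

section FourierIntegral

variable {E : Type*} [NormedAddCommGroup E] [InnerProductSpace ℝ E] [MeasurableSpace E]
  {m : Measure E} {g : E → ℂ}

theorem fourierIntegral_fourierChar_smul (g : E → ℂ) (a b : E) :
    𝓕[m] (fun x => 𝐞 ⟪x, a⟫ • g x) b = 𝓕[m] g (b - a) := by
  simp only [VectorFourier.fourierIntegral, smul_smul, ← AddChar.map_add_eq_mul, innerₗ_apply_apply,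
    inner_sub_right, neg_sub, neg_add_eq_sub]

theorem ofReal_norm_fourierIntegral_sq [SFinite m] (g : E → ℂ) (t : E) :
    ((‖𝓕[m] g t‖ ^ 2 : ℝ) : ℂ) =
      ∫ p, 𝐞 ⟪p.2 - p.1, t⟫ • (g p.1 * conj (g p.2)) ∂m.prod m := by
  rw [← Complex.normSq_eq_norm_sq, ← Complex.mul_conj, VectorFourier.fourierIntegral,
    ← integral_conj, ← integral_prod_mul]
  refine integral_congr_ae (Eventually.of_forall fun p => ?_)
  simp only [innerₗ_apply_apply, Circle.smul_def, smul_eq_mul, map_mul, inner_sub_left,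
    ← Circle.coe_inv_eq_conj, ← AddChar.map_neg_eq_inv, neg_neg]
  rw [sub_eq_neg_add, AddChar.map_add_eq_mul, Circle.coe_mul]
  ring

theorem charFun_eq_integral_fourierChar (γ : Measure E) (c : ℝ) (x : E) :
    charFun γ ((2 * Real.pi * c) • x) = ∫ z, (𝐞 ⟪x, c • z⟫ : ℂ) ∂γ := by
  rw [charFun_apply]
  refine integral_congr_ae (Eventually.of_forall fun z => ?_)
  simp only [Real.fourierChar_apply, inner_smul_right, real_inner_comm x, mul_assoc]

variable [BorelSpace E]

theorem integrable_fourierChar_smul (hg : Integrable g m) (a : E) :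
    Integrable (fun x => 𝐞 ⟪x, a⟫ • g x) m := by
  simpa [inner_neg_right] using (Real.fourierIntegral_convergent_iff (-a)).2 hg

theorem ofReal_integral_norm_fourierIntegral_sq [SecondCountableTopology E] [SFinite m]
    (hg : Integrable g m) (γ : Measure E) [IsFiniteMeasure γ] (c : ℝ) :
    ((∫ z, ‖𝓕[m] g (c • z)‖ ^ 2 ∂γ : ℝ) : ℂ) =
      ∫ p, charFun γ ((2 * Real.pi * c) • (p.2 - p.1)) * (g p.1 * conj (g p.2)) ∂m.prod m := by
  have hcont : Continuous fun q : E × E × E =>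
      (𝐞 ⟪q.2.2 - q.2.1, c • q.1⟫ : ℂ) :=
    continuous_subtype_val.comp (Real.continuous_fourierChar.comp (by fun_prop))
  have hint : Integrable (fun q : E × E × E =>
      (𝐞 ⟪q.2.2 - q.2.1, c • q.1⟫ : ℂ) * (g q.2.1 * conj (g q.2.2)))
      (γ.prod (m.prod m)) :=
    ((integrable_mul_conj_prod hg).comp_snd γ).bdd_mul (c := 1) hcont.aestronglyMeasurable
      (Eventually.of_forall fun q => (Circle.norm_coe _).le)
  simp_rw [← integral_complex_ofReal, ofReal_norm_fourierIntegral_sq, Circle.smul_def, smul_eq_mul]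
  rw [integral_integral_swap hint]
  simp_rw [integral_mul_const, charFun_eq_integral_fourierChar]

theorem tendsto_fourierIntegral_zero_of_denseRange {κ ι : Type*} {d : κ → Lp ℂ 1 m}
    (hd : DenseRange d) {l : Filter ι} {t : ι → E}
    (hlim : ∀ k, Tendsto (fun j => 𝓕[m] (d k) (t j)) l (𝓝 0)) (hg : Integrable g m) :
    Tendsto (fun j => 𝓕[m] g (t j)) l (𝓝 0) := by
  refine Metric.tendsto_nhds.2 fun ε hε => ?_
  obtain ⟨k, hk⟩ := Metric.denseRange_iff.1 hd hg.toL1 (ε / 2) (half_pos hε)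
  have hdk : Integrable (d k) m := L1.integrable_coeFn (d k)
  have hclose : ∫ x, ‖(g - ⇑(d k)) x‖ ∂m < ε / 2 := by
    rw [dist_eq_norm, L1.norm_eq_integral_norm] at hk
    refine lt_of_eq_of_lt (integral_congr_ae ?_) hk
    filter_upwards [hg.coeFn_toL1, Lp.coeFn_sub hg.toL1 (d k)] with x hgx hsub
    rw [hsub, Pi.sub_apply, Pi.sub_apply, hgx]
  filter_upwards [(Metric.tendsto_nhds.1 (hlim k)) _ (half_pos hε)] with j hj
  have hsplit : 𝓕[m] g = 𝓕[m] (g - ⇑(d k)) + 𝓕[m] (d k) := by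
    rw [← VectorFourier.fourierIntegral_add Real.continuous_fourierChar
      (show Continuous fun p : E × E => innerₗ E p.1 p.2 from continuous_inner) (hg.sub hdk) hdk,
      sub_add_cancel]
  calc dist (𝓕[m] g (t j)) 0
      ≤ ‖𝓕[m] (g - ⇑(d k)) (t j)‖ + ‖𝓕[m] (d k) (t j)‖ := by
        rw [dist_zero_right, hsplit]
        exact norm_add_le _ _
    _ < ε / 2 + ε / 2 :=
        add_lt_add ((VectorFourier.norm_fourierIntegral_le_integral_norm ..).trans_lt hclose)
          (by rwa [dist_zero_right] at hj)
    _ = ε := add_halves ε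

theorem tendsto_fourierIntegral_of_ae_tendsto_one {ι : Type*} {l : Filter ι}
    [l.IsCountablyGenerated] {t : ι → E} (hg : Integrable g m)
    (ht : ∀ᵐ x ∂m, Tendsto (fun j => 𝐞 (-⟪x, t j⟫)) l (𝓝 1)) :
    Tendsto (fun j => 𝓕[m] g (t j)) l (𝓝 (∫ x, g x ∂m)) := by
  refine tendsto_integral_filter_of_dominated_convergence (fun x => ‖g x‖)
    (Eventually.of_forall fun j => ?_) (Eventually.of_forall fun j => ?_) hg.norm ?_
  · exact ((Real.fourierIntegral_convergent_iff (t j)).2 hg).aestronglyMeasurable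
  · exact Eventually.of_forall fun x => (Circle.norm_smul _ _).le
  · filter_upwards [ht] with x hx
    simpa using hx.smul_const (g x)

variable [FiniteDimensional ℝ E]

theorem tendsto_charFun_stdGaussian_smul {x : E} (hx : x ≠ 0) :
    Tendsto (fun c : ℝ => charFun (stdGaussian E) (c • x)) atTop (𝓝 0) := by
  have hexponent : Tendsto (fun c : ℝ => (c * ‖x‖) ^ 2 / 2) atTop atTop :=
    ((tendsto_pow_atTop two_ne_zero).comp
      (tendsto_id.atTop_mul_const (norm_pos_iff.2 hx))).atTop_div_const two_pos
  rw [tendsto_zero_iff_norm_tendsto_zero]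
  refine (Real.tendsto_exp_neg_atTop_nhds_zero.comp hexponent).congr fun c => ?_
  rw [charFun_stdGaussian, norm_smul, Complex.norm_exp]
  norm_cast
  simp [mul_pow, neg_div]

theorem tendsto_integral_norm_fourierIntegral_sq_stdGaussian [SFinite m] [NullSingletonClass m]
    (hg : Integrable g m) :
    Tendsto (fun c : ℝ => ∫ z, ‖𝓕[m] g (c • z)‖ ^ 2 ∂stdGaussian E) atTop (𝓝 0) := by
  have hoff : ∀ᵐ p ∂m.prod m, p.2 - p.1 ≠ 0 := by
    rw [ae_iff]
    simpa [sub_eq_zero, Set.diagonal, eq_comm] using measure_prod_diagonal m m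
  have hdct : Tendsto (fun c : ℝ => ∫ p, charFun (stdGaussian E)
      ((2 * Real.pi * c) • (p.2 - p.1)) * (g p.1 * conj (g p.2)) ∂m.prod m) atTop
      (𝓝 (∫ _, (0 : ℂ) ∂m.prod m)) := by
    refine tendsto_integral_filter_of_dominated_convergence
      (fun p => ‖g p.1 * conj (g p.2)‖) (Eventually.of_forall fun c => ?_)
      (Eventually.of_forall fun c => Eventually.of_forall fun p => ?_)
      (integrable_mul_conj_prod hg).norm ?_
    · exact (continuous_charFun.comp (by fun_prop)).aestronglyMeasurable.mul
        (integrable_mul_conj_prod hg).aestronglyMeasurable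
    · rw [norm_mul]
      exact mul_le_of_le_one_left (norm_nonneg _) (norm_charFun_le_one _)
    · filter_upwards [hoff] with p hp
      simpa using ((tendsto_charFun_stdGaussian_smul hp).comp
        (tendsto_id.const_mul_atTop Real.two_pi_pos)).mul_const (g p.1 * conj (g p.2))
  simp_rw [← ofReal_integral_norm_fourierIntegral_sq hg, integral_zero] at hdct
  rwa [← Complex.ofReal_zero, tendsto_ofReal_iff] at hdct

theorem exists_forall_norm_fourierIntegral_lt [SFinite m] [NullSingletonClass m] {ι : Type*}
    (s : Finset ι) {g : ι → E → ℂ} (hg : ∀ i ∈ s, Integrable (g i) m) {ε : ℝ} (hε : 0 < ε) :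
    ∃ t : E, ∀ i ∈ s, ‖𝓕[m] (g i) t‖ < ε := by
  have hlim : Tendsto (fun c : ℝ => ∑ i ∈ s, ∫ z, ‖𝓕[m] (g i) (c • z)‖ ^ 2 ∂stdGaussian E)
      atTop (𝓝 0) := by
    simpa using tendsto_finsetSum s fun i hi =>
      tendsto_integral_norm_fourierIntegral_sq_stdGaussian (hg i hi)
  obtain ⟨c, hc⟩ := (hlim.eventually_lt_const (pow_pos hε 2)).exists
  have hint : ∀ i ∈ s, Integrable (fun z : E => ‖𝓕[m] (g i) (c • z)‖ ^ 2) (stdGaussian E) := by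
    intro i hi
    have hcont : Continuous (𝓕[m] (g i)) :=
      VectorFourier.fourierIntegral_continuous Real.continuous_fourierChar continuous_inner
        (hg i hi)
    refine Integrable.of_bound (C := (∫ x, ‖g i x‖ ∂m) ^ 2)
      ((hcont.comp (by fun_prop)).norm.pow 2).aestronglyMeasurable
      (Eventually.of_forall fun z => ?_)
    rw [norm_pow, norm_norm]
    gcongr
    exact VectorFourier.norm_fourierIntegral_le_integral_norm ..
  rw [← integral_finsetSum s hint] at hc
  obtain ⟨z, hz⟩ := exists_le_integral (μ := stdGaussian E) (integrable_finsetSum s hint)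
  refine ⟨c • z, fun i hi => lt_of_pow_lt_pow_left₀ 2 hε.le ((le_trans ?_ hz).trans_lt hc)⟩
  exact Finset.single_le_sum (f := fun i => ‖𝓕[m] (g i) (c • z)‖ ^ 2)
    (fun _ _ => by positivity) hi

section Recurrence

variable [NullSingletonClass m] {G : Type*} [CommGroup G] [TopologicalSpace G]
  [IsTopologicalGroup G] [CompactSpace G]

theorem exists_addChar_mem_and_norm_fourierIntegral_lt [SFinite m] (ψ : AddChar E G) {U : Set G}
    (hU : U ∈ 𝓝 1) {ι : Type*} (s : Finset ι) {g : ι → E → ℂ} (hg : ∀ i ∈ s, Integrable (g i) m)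
    {ε : ℝ} (hε : 0 < ε) :
    ∃ t : E, ψ t ∈ U ∧ ∀ i ∈ s, ‖𝓕[m] (g i) t‖ < ε := by
  have hstep : ∀ A : Finset E, ∃ b, ∀ a ∈ A, ∀ i ∈ s, ‖𝓕[m] (g i) (b - a)‖ < ε := by
    intro A
    obtain ⟨b, hb⟩ := exists_forall_norm_fourierIntegral_lt (m := m) (A ×ˢ s)
      (g := fun q x => 𝐞 ⟪x, q.1⟫ • g q.2 x)
      (fun q hq => integrable_fourierChar_smul (hg q.2 (Finset.mem_product.1 hq).2) q.1) hε
    refine ⟨b, fun a ha i hi => ?_⟩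
    simpa only [fourierIntegral_fourierChar_smul] using hb (a, i) (Finset.mk_mem_product ha hi)
  obtain ⟨σ, -, hσ⟩ := exists_seq_of_forall_finset_exists (fun _ : E => True)
    (fun a b => ∀ i ∈ s, ‖𝓕[m] (g i) (b - a)‖ < ε)
    (fun A _ => (hstep A).imp fun b hb => ⟨trivial, hb⟩)
  obtain ⟨i, j, hij, hmem⟩ := exists_lt_div_mem_of_compactSpace (ψ ∘ σ) hU
  exact ⟨σ j - σ i, by rwa [ψ.map_sub_eq_div], hσ i j hij⟩

theorem exists_seq_tendsto_addChar_one_and_fourierIntegral_zero [SigmaFinite m]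
    [FirstCountableTopology G] (ψ : AddChar E G) :
    ∃ t : ℕ → E, Tendsto (fun j => ψ (t j)) atTop (𝓝 1) ∧
      ∀ g : E → ℂ, Integrable g m → Tendsto (fun j => 𝓕[m] g (t j)) atTop (𝓝 0) := by
  have : Fact ((1 : ℝ≥0∞) ≠ ∞) := ⟨ENNReal.one_ne_top⟩
  let d := TopologicalSpace.denseSeq (Lp ℂ 1 m)
  obtain ⟨U, hU⟩ := (𝓝 (1 : G)).exists_antitone_basis
  have hex : ∀ j : ℕ, ∃ t : E, ψ t ∈ U j ∧
      ∀ k ∈ Finset.range j, ‖𝓕[m] (d k) t‖ < 1 / ((j : ℝ) + 1) := fun j =>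
    exists_addChar_mem_and_norm_fourierIntegral_lt ψ (hU.mem j) (Finset.range j)
      (fun k _ => L1.integrable_coeFn (d k)) (by positivity)
  choose t hψ hsmall using hex
  refine ⟨t, hU.tendsto hψ, fun g hg =>
    tendsto_fourierIntegral_zero_of_denseRange (TopologicalSpace.denseRange_denseSeq _)
      (fun k => ?_) hg⟩
  refine squeeze_zero_norm' ?_ tendsto_one_div_add_atTop_nhds_zero_nat
  filter_upwards [eventually_gt_atTop k] with j hj using (hsmall j k (Finset.mem_range.2 hj)).le

end Recurrence

theorem exists_seq_tendsto_fourierIntegral_setIntegral [SigmaFinite m] {S : Set E}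
    (hS : S.Countable) [NullSingletonClass (m.restrict Sᶜ)] :
    ∃ t : ℕ → E, ∀ g : E → ℂ, Integrable g m →
      Tendsto (fun j => 𝓕[m] g (t j)) atTop (𝓝 (∫ x in S, g x ∂m)) := by
  have := hS.to_subtype
  let ψ : AddChar E (S → Circle) :=
    { toFun := fun t s => 𝐞 (-⟪(s : E), t⟫)
      map_zero_eq_one' := by ext; simp
      map_add_eq_mul' := fun t u => by
        funext s
        simp only [inner_add_right, neg_add, AddChar.map_add_eq_mul, Pi.mul_apply] }
  obtain ⟨t, hone, hzero⟩ :=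
    exists_seq_tendsto_addChar_one_and_fourierIntegral_zero (m := m.restrict Sᶜ) ψ
  refine ⟨t, fun g hg => ?_⟩
  have hatoms : Tendsto (fun j => 𝓕[m.restrict S] g (t j)) atTop (𝓝 (∫ x in S, g x ∂m)) := by
    refine tendsto_fourierIntegral_of_ae_tendsto_one hg.restrict ?_
    filter_upwards [ae_restrict_mem hS.measurableSet] with x hx
    exact tendsto_pi_nhds.1 hone ⟨x, hx⟩
  refine (add_zero (∫ x in S, g x ∂m) ▸ hatoms.add (hzero g hg.restrict)).congr fun j => ?_
  exact integral_add_compl hS.measurableSet ((Real.fourierIntegral_convergent_iff (t j)).2 hg)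

end FourierIntegral

theorem exists_schwartzMap_eq_one_of_forall_le_norm_eq_zero (E : Type*) [NormedAddCommGroup E]
    [NormedSpace ℝ E] [FiniteDimensional ℝ E] {δ : ℝ} (hδ : 0 < δ) :
    ∃ ψ : 𝓢(E, ℂ), ψ 0 = 1 ∧ ∀ x, δ ≤ ‖x‖ → ψ x = 0 := by
  let b : ContDiffBump (0 : E) := ⟨δ / 2, δ, half_pos hδ, half_lt_self hδ⟩
  have hsupp : HasCompactSupport fun x => (b x : ℂ) :=
    b.hasCompactSupport.comp_left (g := fun x : ℝ => (x : ℂ)) Complex.ofReal_zero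
  refine ⟨hsupp.toSchwartzMap (Complex.ofRealCLM.contDiff.comp b.contDiff), ?_, fun x hx => ?_⟩
  · change ((b 0 : ℝ) : ℂ) = 1
    rw [b.one_of_mem_closedBall (Metric.mem_closedBall_self (half_pos hδ).le), Complex.ofReal_one]
  · change ((b x : ℝ) : ℂ) = 0
    rw [b.zero_of_le_dist (by rwa [dist_zero_right]), Complex.ofReal_zero]

theorem schwartzMap_fourierInv_compSubConstCLM_apply {E : Type*} [NormedAddCommGroup E]
    [InnerProductSpace ℝ E] [FiniteDimensional ℝ E] [MeasurableSpace E] [BorelSpace E]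
    (φ : 𝓢(E, ℂ)) (τ s : E) :
    𝓕⁻ (φ.compSubConstCLM ℂ τ) s = 𝐞 ⟪τ, s⟫ • 𝓕⁻ φ s := by
  rw [SchwartzMap.fourierInv_coe, SchwartzMap.fourierInv_coe, Real.fourierInv_eq,
    Real.fourierInv_eq, ← integral_add_right_eq_self _ τ, Circle.smul_def, ← integral_smul]
  refine integral_congr_ae (Eventually.of_forall fun v => ?_)
  simp only [SchwartzMap.compSubConstCLM_apply, add_sub_cancel_right, ← Circle.smul_def, smul_smul,
    ← AddChar.map_add_eq_mul, inner_add_left, add_comm ⟪τ, s⟫]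

theorem preimage_add_right_sub_preimage_add_right {G : Type*} [AddGroup G] (A B : Set G)
    (a : G) : (· + a) ⁻¹' A - (· + a) ⁻¹' B = A - B := by
  ext z
  constructor
  · rintro ⟨x, hx, y, hy, rfl⟩
    exact ⟨x + a, hx, y + a, hy, add_sub_add_right_eq_sub x y a⟩
  · rintro ⟨x, hx, y, hy, rfl⟩
    exact ⟨x - a, by simpa, y - a, by simpa, sub_sub_sub_cancel_right x y a⟩

theorem IsSlowlyIncreasing.isLocallyFiniteMeasure {n : ℕ} {m : Measure (Eucl n)}
    (h : IsSlowlyIncreasing m) : IsLocallyFiniteMeasure m := by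
  obtain ⟨N, C, hC⟩ := h
  refine ⟨fun x => ⟨Metric.ball 0 (‖x‖ + 1), Metric.isOpen_ball.mem_nhds (by simp), ?_⟩⟩
  exact (hC _ (by simp)).trans_lt ENNReal.ofReal_lt_top

namespace SIMeasure

variable {n : ℕ} {μ ν : SIMeasure n}

instance : IsLocallyFiniteMeasure μ.variation := μ.slowlyIncreasing.isLocallyFiniteMeasure

theorem mass_singleton (μ : SIMeasure n) (x : Eucl n) :
    μ.mass {x} = μ.variation.real {x} • μ.phase x :=
  integral_singleton _ _

theorem phase_ne_zero (μ : SIMeasure n) (x : Eucl n) : μ.phase x ≠ 0 :=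
  norm_ne_zero_iff.1 (μ.norm_phase x ▸ one_ne_zero)

theorem mem_atoms_iff {x : Eucl n} : x ∈ μ.atoms ↔ μ.variation {x} ≠ 0 := by
  simp [atoms, mass_singleton, μ.phase_ne_zero x, measureReal_def, ENNReal.toReal_eq_zero_iff,
    measure_singleton_lt_top.ne]

theorem countable_atoms (μ : SIMeasure n) : μ.atoms.Countable :=
  (Measure.countable_meas_pos_of_disjoint_iUnion (μ := μ.variation)
    (As := fun x : Eucl n => {x}) measurableSet_singleton fun x y hxy => by
      simpa [Function.onFun] using hxy).mono fun _ hx => pos_iff_ne_zero.2 (mem_atoms_iff.1 hx)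

instance : NullSingletonClass (μ.variation.restrict μ.atomsᶜ) where
  measure_singleton x := by
    rw [Measure.restrict_apply (measurableSet_singleton x)]
    by_cases hx : x ∈ μ.atoms
    · simp [hx]
    · exact measure_mono_null Set.inter_subset_left (not_not.1 (mem_atoms_iff.not.1 hx))

theorem integrable_mul_phase (μ : SIMeasure n) (φ : 𝓢(Eucl n, ℂ)) :
    Integrable (fun x => φ x * μ.phase x) μ.variation := by
  have := μ.slowlyIncreasing.hasTemperateGrowth
  exact φ.integrable.mul_bdd (c := 1) μ.measurable_phase.aestronglyMeasurable
    (Eventually.of_forall fun x => (μ.norm_phase x).le)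

theorem toDistribution_apply_eq_mass_singleton_mul (hμ : μ.IsPurePoint) {φ : 𝓢(Eucl n, ℂ)}
    {x : Eucl n} (hφ : ∀ y ∈ μ.atoms, y ≠ x → φ y = 0) :
    μ.toDistribution φ = μ.mass {x} * φ x := by
  have hoff : ∀ᵐ y ∂μ.variation, y ∉ ({x} : Set (Eucl n)) → φ y * μ.phase y = 0 := by
    filter_upwards [compl_mem_ae_iff.2 hμ] with y hy hyx
    rw [hφ y (not_not.1 hy) hyx, zero_mul]
  rw [toDistribution_apply, ← setIntegral_eq_integral_of_ae_compl_eq_zero hoff, integral_singleton,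
    mass_singleton, smul_mul_assoc, mul_comm]

theorem toDistribution_apply_eq_tsum (hμ : μ.IsPurePoint) {ι : Type*} [Countable ι]
    {p : ι → Eucl n} (hp : p.Injective) (hatoms : μ.atoms ⊆ Set.range p) (φ : 𝓢(Eucl n, ℂ)) :
    μ.toDistribution φ = ∑' k, μ.mass {p k} * φ (p k) := by
  have hrange : μ.variation.restrict (Set.range p) = μ.variation :=
    Measure.restrict_eq_self_of_ae_mem <| mem_of_superset (compl_mem_ae_iff.2 hμ) <| by
      rwa [compl_compl]
  rw [toDistribution_apply, ← hrange, setIntegral_countable _ (Set.countable_range p)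
    (μ.integrable_mul_phase φ).integrableOn, ← (Equiv.ofInjective p hp).tsum_eq]
  refine tsum_congr fun k => ?_
  rw [Equiv.ofInjective_apply, mass_singleton, smul_mul_assoc, mul_comm (μ.phase _)]

theorem mass_translate_singleton (μ : SIMeasure n) (τ x : Eucl n) :
    (μ.translate τ).mass {x} = μ.mass {x + τ} := by
  have hpre : (fun y => y - τ) ⁻¹' {x} = {x + τ} := by
    ext y
    simp [sub_eq_iff_eq_add]
  rw [mass_singleton, mass_singleton, translate,
    map_measureReal_apply (by fun_prop) (measurableSet_singleton x), hpre]

theorem atoms_translate (μ : SIMeasure n) (τ : Eucl n) :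
    (μ.translate τ).atoms = (· + τ) ⁻¹' μ.atoms := by
  ext x
  simp [atoms, mass_translate_singleton]

theorem IsPurePoint.translate (hμ : μ.IsPurePoint) (τ : Eucl n) :
    (μ.translate τ).IsPurePoint := by
  have hpre : (fun y => y - τ) ⁻¹' (μ.translate τ).atomsᶜ = μ.atomsᶜ := by
    ext y
    simp [atoms_translate]
  rw [IsPurePoint, SIMeasure.translate, Measure.map_apply (by fun_prop)
    (countable_atoms _).measurableSet.compl]
  exact hpre ▸ hμ

theorem toDistribution_translate_apply (μ : SIMeasure n) (τ : Eucl n) (φ : 𝓢(Eucl n, ℂ)) :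
    (μ.translate τ).toDistribution φ = μ.toDistribution (φ.compSubConstCLM ℂ τ) := by
  have hmeas : Measurable fun x => φ x * μ.phase (x + τ) :=
    φ.continuous.measurable.mul (μ.measurable_phase.comp (by fun_prop))
  rw [toDistribution_apply, toDistribution_apply, translate,
    integral_map (by fun_prop) hmeas.aestronglyMeasurable]
  simp

theorem toDistribution_translate_apply_of_fourier_eq (hν : 𝓕 μ.toDistribution = ν.toDistribution)
    (τ : Eucl n) (φ : 𝓢(Eucl n, ℂ)) :
    (μ.translate τ).toDistribution φ =
      𝓕[ν.variation] (fun s => 𝓕⁻ φ s * ν.phase s) (-τ) := by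
  have hpair (ψ : 𝓢(Eucl n, ℂ)) : μ.toDistribution ψ = ν.toDistribution (𝓕⁻ ψ) := by
    rw [← hν, TemperedDistribution.fourier_apply, FourierTransform.fourier_fourierInv_eq]
  rw [toDistribution_translate_apply, hpair, toDistribution_apply]
  refine integral_congr_ae (Eventually.of_forall fun s => ?_)
  simp [schwartzMap_fourierInv_compSubConstCLM_apply, real_inner_comm τ, smul_mul_assoc]

theorem exists_norm_mass_singleton_le (hμ : μ.IsPurePoint)
    (hΛ : IsUniformlyDiscrete μ.atoms) (hν : 𝓕 μ.toDistribution = ν.toDistribution) :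
    ∃ M : ℝ, ∀ x, ‖μ.mass {x}‖ ≤ M := by
  obtain ⟨δ, hδ, hsep⟩ := hΛ
  obtain ⟨ψ, hψ_one, hψ_zero⟩ := exists_schwartzMap_eq_one_of_forall_le_norm_eq_zero (Eucl n) hδ
  refine ⟨∫ s, ‖𝓕⁻ ψ s * ν.phase s‖ ∂ν.variation, fun x => ?_⟩
  by_cases hx : x ∈ μ.atoms
  · have htest : μ.mass {x} = (μ.translate x).toDistribution ψ := by
      rw [toDistribution_apply_eq_mass_singleton_mul (hμ.translate x) (x := 0), hψ_one,
        mass_translate_singleton, zero_add, mul_one]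
      intro y hy hyx
      rw [atoms_translate] at hy
      exact hψ_zero y (by simpa using hsep _ hy x hx (by simpa using hyx))
    rw [htest, toDistribution_translate_apply_of_fourier_eq hν]
    exact VectorFourier.norm_fourierIntegral_le_integral_norm ..
  · rw [not_not.1 hx, norm_zero]
    positivity

theorem exists_seq_tendsto_toDistribution_translate (hν : 𝓕 μ.toDistribution = ν.toDistribution) :
    ∃ τ : ℕ → Eucl n, Tendsto (fun j => (μ.translate (τ j)).toDistribution) atTop
      (𝓝 (𝓕⁻ ν.discretePart.toDistribution)) := by
  obtain ⟨t, ht⟩ := exists_seq_tendsto_fourierIntegral_setIntegral (m := ν.variation)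
    ν.countable_atoms
  refine ⟨fun j => -t j, PointwiseConvergenceCLM.tendsto_iff_forall_tendsto.2 fun φ => ?_⟩
  simp only [toDistribution_translate_apply_of_fourier_eq hν, neg_neg,
    TemperedDistribution.fourierInv_apply, toDistribution_apply]
  exact ht _ (ν.integrable_mul_phase (𝓕⁻ φ))

end SIMeasure

section SeparatedSets

/-- The lower limit of the sets `A j` along `l`, in the sense of Kuratowski: the set of limits of
families of points which eventually lie in the `A j`. -/
def lowerLimit {ι X : Type*} [TopologicalSpace X] (l : Filter ι) (A : ι → Set X) : Set X :=
  {x | ∃ q : ι → X, Tendsto q l (𝓝 x) ∧ ∀ᶠ j in l, q j ∈ A j}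

variable {ι : Type*} {l : Filter ι}

theorem lowerLimit_sub_lowerLimit_subset {G : Type*} [TopologicalSpace G] [Sub G]
    [ContinuousSub G] (A B : ι → Set G) :
    lowerLimit l A - lowerLimit l B ⊆ lowerLimit l fun j => A j - B j := by
  rintro _ ⟨x, ⟨q, hq, hqA⟩, y, ⟨r, hr, hrB⟩, rfl⟩
  exact ⟨fun j => q j - r j, hq.sub hr, hqA.mp (hrB.mono fun _ hB hA => Set.sub_mem_sub hA hB)⟩

theorem pairwise_le_dist_lowerLimit {X : Type*} [MetricSpace X] [l.NeBot] {A : ι → Set X} {δ : ℝ}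
    (hA : ∀ j, (A j).Pairwise (δ ≤ dist · ·)) : (lowerLimit l A).Pairwise (δ ≤ dist · ·) := by
  rintro x ⟨q, hq, hqA⟩ y ⟨r, hr, hrA⟩ hxy
  refine ge_of_tendsto (hq.dist hr) ?_
  filter_upwards [hqA, hrA, (hq.dist hr).eventually_ne (dist_ne_zero.2 hxy)] with j hqj hrj hne
  exact hA j hqj hrj (dist_ne_zero.1 hne)

theorem exists_rightInverse_of_injOn {X Z : Type*} {f : X → Z}
    (hf : f.Surjective) {A : Set X} (hA : A.InjOn f) :
    ∃ p : Z → X, Function.RightInverse p f ∧ A ⊆ Set.range p := by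
  classical
  refine ⟨fun z => if h : z ∈ f '' A then h.choose else Function.surjInv hf z, fun z => ?_, ?_⟩
  · by_cases h : z ∈ f '' A
    · simpa [h] using h.choose_spec.2
    · simpa [h] using Function.surjInv_eq hf z
  · intro x hx
    have h : f x ∈ f '' A := Set.mem_image_of_mem f hx
    exact ⟨f x, by simpa [h] using hA h.choose_spec.1 hx h.choose_spec.2⟩

variable (E : Type*) [NormedAddCommGroup E] [NormedSpace ℝ E] [FiniteDimensional ℝ E]

theorem exists_basis_sum_norm_lt {ε : ℝ} (hε : 0 < ε) :
    ∃ b : Module.Basis (Fin (Module.finrank ℝ E)) ℝ E, ∑ i, ‖b i‖ < ε := by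
  let b := Module.finBasis ℝ E
  obtain ⟨c, hc, hcε⟩ := exists_pos_mul_lt hε (∑ i, ‖b i‖)
  refine ⟨b.isUnitSMul fun _ => (IsUnit.mk0 c hc.ne'), ?_⟩
  simpa only [Module.Basis.isUnitSMul_apply, norm_smul, Real.norm_of_nonneg hc.le,
    mul_comm c, ← Finset.sum_mul] using hcε

theorem exists_isZLattice_forall_pairwise_le_dist {δ : ℝ} (hδ : 0 < δ) :
    ∃ (L : Submodule ℤ E) (_ : DiscreteTopology L), IsZLattice ℝ L ∧
      ∀ A : Set E, A.Pairwise (δ ≤ dist · ·) →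
        ∃ p : L → E, p.Injective ∧ A ⊆ Set.range p ∧ ∀ z, dist (p z) z ≤ δ := by
  obtain ⟨b, hb⟩ := exists_basis_sum_norm_lt E (half_pos hδ)
  have hfloor (x : E) : dist x (ZSpan.floor b x) ≤ δ / 2 := by
    rw [dist_eq_norm, ← ZSpan.fract_apply]
    exact (ZSpan.norm_fract_le b x).trans hb.le
  have hsurj : (ZSpan.floor b).Surjective := fun z =>
    ⟨z, Subtype.ext (ZSpan.floor_eq_self_of_mem b z z.2)⟩
  refine ⟨Submodule.span ℤ (Set.range b), inferInstance, inferInstance, fun A hA => ?_⟩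
  have hinj : A.InjOn (ZSpan.floor b) := by
    intro x hx y hy hxy
    by_contra hne
    have hlt : dist x y < δ := by
      have hfract : x - y = ZSpan.fract b x - ZSpan.fract b y := by
        rw [ZSpan.fract_apply, ZSpan.fract_apply, hxy, sub_sub_sub_cancel_right]
      rw [dist_eq_norm, hfract]
      linarith [norm_sub_le (ZSpan.fract b x) (ZSpan.fract b y), ZSpan.norm_fract_le b x,
        ZSpan.norm_fract_le b y]
    exact (hA hx hy hne).not_gt hlt
  obtain ⟨p, hp, hAp⟩ := exists_rightInverse_of_injOn hsurj hinj
  refine ⟨p, hp.injective, hAp, fun z => ?_⟩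
  simpa only [hp z] using (hfloor (p z)).trans (half_le_self hδ.le)

end SeparatedSets

section Decay

variable {E : Type*} [NormedAddCommGroup E]

theorem inv_one_add_norm_pow_le_of_dist_le {x z : E} {r : ℝ} (h : dist x z ≤ r) (N : ℕ) :
    ((1 + ‖x‖) ^ N)⁻¹ ≤ (1 + r) ^ N * ((1 + ‖z‖) ^ N)⁻¹ := by
  have hr : 0 ≤ r := dist_nonneg.trans h
  have hz : 1 + ‖z‖ ≤ (1 + r) * (1 + ‖x‖) := by
    rw [dist_eq_norm'] at h
    nlinarith [norm_le_norm_add_norm_sub' z x, norm_nonneg x]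
  rw [← div_eq_mul_inv, inv_le_iff_one_le_mul₀ (by positivity), div_mul_eq_mul_div,
    one_le_div (by positivity), ← mul_pow]
  gcongr

variable {κ : Type*} {w : κ → E} {N : ℕ} {M r : ℝ}

theorem summable_norm_mul_inv_one_add_norm_pow_of_dist_le
    (hw : Summable fun k => ((1 + ‖w k‖) ^ N)⁻¹) {c : κ → ℂ} (hc : ∀ k, ‖c k‖ ≤ M)
    {p : κ → E} (hp : ∀ k, dist (p k) (w k) ≤ r) :
    Summable fun k => ‖c k‖ * ((1 + ‖p k‖) ^ N)⁻¹ := by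
  refine (hw.mul_left (M * (1 + r) ^ N)).of_nonneg_of_le (fun k => by positivity) fun k => ?_
  rw [mul_assoc]
  exact mul_le_mul (hc k) (inv_one_add_norm_pow_le_of_dist_le (hp k) N) (by positivity)
    ((norm_nonneg _).trans (hc k))

variable [NormedSpace ℝ E]

theorem summable_inv_one_add_norm_pow [FiniteDimensional ℝ E] (L : Submodule ℤ E)
    [DiscreteTopology L] [IsZLattice ℝ L] :
    Summable fun z : L => ((1 + ‖(z : E)‖) ^ (Module.finrank ℝ E + 1))⁻¹ := by
  have hrank : Module.finrank ℤ L < Module.finrank ℝ E + 1 := by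
    rw [ZLattice.rank ℝ L]
    exact Nat.lt_succ_self _
  refine (ZLattice.summable_norm_pow_inv L _ hrank).of_norm_bounded_eventually ?_
  filter_upwards [(Set.finite_singleton (0 : L)).compl_mem_cofinite] with z hz
  have hz : 0 < ‖z‖ := norm_pos_iff.2 hz
  rw [Real.norm_of_nonneg (by positivity), inv_pow]
  gcongr
  exact le_add_of_nonneg_left zero_le_one

theorem schwartzMap_exists_norm_le_mul_inv_one_add_norm_pow {F : Type*} [NormedAddCommGroup F]
    [NormedSpace ℝ F] (φ : 𝓢(E, F)) (N : ℕ) :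
    ∃ C, 0 ≤ C ∧ ∀ x, ‖φ x‖ ≤ C * ((1 + ‖x‖) ^ N)⁻¹ := by
  have h := SchwartzMap.one_add_le_sup_seminorm_apply (𝕜 := ℝ) (m := (N, 0)) (k := N) (n := 0)
    le_rfl le_rfl φ
  simp only [norm_iteratedFDeriv_zero] at h
  refine ⟨_, le_trans (by positivity) (h 0), fun x => ?_⟩
  rw [← div_eq_mul_inv, le_div_iff₀ (by positivity), mul_comm]
  exact h x

theorem tendsto_tsum_mul_schwartzMap {ι : Type*} {l : Filter ι}
    (hw : Summable fun k => ((1 + ‖w k‖) ^ N)⁻¹) {c : ι → κ → ℂ} (hc : ∀ j k, ‖c j k‖ ≤ M)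
    {p : ι → κ → E} (hp : ∀ j k, dist (p j k) (w k) ≤ r) {c' : κ → ℂ} {p' : κ → E}
    (hc' : ∀ k, Tendsto (c · k) l (𝓝 (c' k))) (hp' : ∀ k, Tendsto (p · k) l (𝓝 (p' k)))
    (φ : 𝓢(E, ℂ)) :
    Tendsto (fun j => ∑' k, c j k * φ (p j k)) l (𝓝 (∑' k, c' k * φ (p' k))) := by
  obtain ⟨C, hC, hφ⟩ := schwartzMap_exists_norm_le_mul_inv_one_add_norm_pow φ N
  refine tendsto_tsum_of_dominated_convergence (hw.mul_left (M * (C * (1 + r) ^ N)))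
    (fun k => (hc' k).mul ((φ.continuous.tendsto _).comp (hp' k)))
    (Eventually.of_forall fun j k => ?_)
  have hM : 0 ≤ M := (norm_nonneg _).trans (hc j k)
  calc ‖c j k * φ (p j k)‖ ≤ M * (C * ((1 + r) ^ N * ((1 + ‖w k‖) ^ N)⁻¹)) := by
        rw [norm_mul]
        gcongr
        · exact hc j k
        · exact (hφ _).trans
            (mul_le_mul_of_nonneg_left (inv_one_add_norm_pow_le_of_dist_le (hp j k) N) hC)
    _ = M * (C * (1 + r) ^ N) * ((1 + ‖w k‖) ^ N)⁻¹ := by ring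

end Decay

namespace SIMeasure

variable {n : ℕ}

section OfAtoms

variable {ι : Type*} {c : ι → ℂ} {p : ι → Eucl n} {N : ℕ}

theorem isSlowlyIncreasing_sum_dirac (hsum : Summable fun k => ‖c k‖ * ((1 + ‖p k‖) ^ N)⁻¹) :
    IsSlowlyIncreasing (Measure.sum fun k => ‖c k‖ₑ • Measure.dirac (p k)) := by
  refine ⟨N, (∑' k, ‖c k‖ * ((1 + ‖p k‖) ^ N)⁻¹) * 2 ^ N, fun R hR => ?_⟩
  rw [Measure.sum_apply _ Metric.isOpen_ball.measurableSet, mul_assoc, ← tsum_mul_right,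
    ENNReal.ofReal_tsum_of_nonneg (fun k => by positivity) (hsum.mul_right _)]
  refine ENNReal.tsum_le_tsum fun k => ?_
  rw [Measure.smul_apply, Measure.dirac_apply' _ Metric.isOpen_ball.measurableSet, smul_eq_mul]
  by_cases hk : p k ∈ Metric.ball 0 R
  · rw [Set.indicator_of_mem hk, Pi.one_apply, mul_one, ← ofReal_norm, mul_assoc]
    refine ENNReal.ofReal_le_ofReal (le_mul_of_one_le_right (norm_nonneg _) ?_)
    rw [inv_mul_eq_div, one_le_div (by positivity), ← mul_pow]
    rw [mem_ball_zero_iff] at hk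
    gcongr
    linarith
  · rw [Set.indicator_of_notMem hk, mul_zero]
    exact zero_le

variable [Countable ι]

/-- The pure point measure `∑ c k • δ (p k)`, where the points `p k` are meant to be distinct: at a
repeated point the moduli of the masses are added up. -/
noncomputable def ofAtoms (c : ι → ℂ) (p : ι → Eucl n) (N : ℕ)
    (hsum : Summable fun k => ‖c k‖ * ((1 + ‖p k‖) ^ N)⁻¹) : SIMeasure n where
  variation := Measure.sum fun k => ‖c k‖ₑ • Measure.dirac (p k)
  phase x := Complex.exp (Complex.arg (Function.extend p c 0 x) * Complex.I)
  measurable_phase := by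
    have hextend : Measurable (Function.extend p c 0) :=
      (measurable_const (a := (0 : ℂ))).measurable_of_countable_ne <|
        (Set.countable_range p).mono fun x hx => by
          by_contra hxp
          exact hx (Function.extend_apply' c (0 : Eucl n → ℂ) x hxp).symm
    fun_prop
  norm_phase _ := Complex.norm_exp_ofReal_mul_I _
  slowlyIncreasing := isSlowlyIncreasing_sum_dirac hsum

variable (hsum : Summable fun k => ‖c k‖ * ((1 + ‖p k‖) ^ N)⁻¹)

theorem variation_ofAtoms_apply {s : Set (Eucl n)} (hs : MeasurableSet s) :
    (ofAtoms c p N hsum).variation s = ∑' k, ‖c k‖ₑ * s.indicator 1 (p k) := by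
  simp only [ofAtoms, Measure.sum_apply _ hs, Measure.smul_apply, Measure.dirac_apply' _ hs,
    smul_eq_mul]

theorem atoms_ofAtoms : (ofAtoms c p N hsum).atoms = p '' Function.support c := by
  ext x
  rw [mem_atoms_iff, variation_ofAtoms_apply hsum (measurableSet_singleton x), ne_eq,
    ENNReal.tsum_eq_zero]
  simp [Set.indicator_apply, and_comm]

theorem isPurePoint_ofAtoms : (ofAtoms c p N hsum).IsPurePoint := by
  rw [IsPurePoint, variation_ofAtoms_apply hsum (countable_atoms _).measurableSet.compl,
    ENNReal.tsum_eq_zero]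
  intro k
  by_cases hk : c k = 0
  · simp [hk]
  · have hmem : p k ∉ (ofAtoms c p N hsum).atomsᶜ := by
      rw [atoms_ofAtoms]
      exact Set.notMem_compl_iff.2 ⟨k, hk, rfl⟩
    rw [Set.indicator_of_notMem hmem, mul_zero]

theorem toDistribution_ofAtoms_apply (hp : p.Injective) (φ : 𝓢(Eucl n, ℂ)) :
    (ofAtoms c p N hsum).toDistribution φ = ∑' k, c k * φ (p k) := by
  obtain ⟨C, -, hφ⟩ := schwartzMap_exists_norm_le_mul_inv_one_add_norm_pow φ N
  have hbound (k : ι) : ‖c k‖ * (C * ((1 + ‖p k‖) ^ N)⁻¹) =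
      C * (‖c k‖ * ((1 + ‖p k‖) ^ N)⁻¹) := mul_left_comm _ _ _
  simp only [toDistribution_apply, ofAtoms]
  rw [integral_sum_dirac_eq_tsum (fun k => enorm_ne_top)]
  · refine tsum_congr fun k => ?_
    rw [toReal_enorm, Complex.real_smul, hp.extend_apply, mul_left_comm,
      Complex.norm_mul_exp_arg_mul_I, mul_comm]
  · refine (hsum.mul_left C).of_nonneg_of_le (fun k => by positivity) fun k => ?_
    rw [toReal_enorm, norm_mul, Complex.norm_exp_ofReal_mul_I, mul_one, ← hbound]
    gcongr
    exact hφ _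

end OfAtoms

theorem exists_isPurePoint_atoms_eq_image {ι : Type*} [Countable ι] {c : ι → ℂ} {p : ι → Eucl n}
    {N : ℕ} (hsum : Summable fun k => ‖c k‖ * ((1 + ‖p k‖) ^ N)⁻¹)
    (hp : (Function.support c).InjOn p) :
    ∃ μ : SIMeasure n, μ.IsPurePoint ∧ μ.atoms = p '' Function.support c ∧
      ∀ φ : 𝓢(Eucl n, ℂ), μ.toDistribution φ = ∑' k, c k * φ (p k) := by
  let c' : Function.support c → ℂ := fun k => c k
  have hc' : Function.support c' = Set.univ := Set.eq_univ_of_forall fun k => k.2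
  have hsum' : Summable fun k : Function.support c => ‖c' k‖ * ((1 + ‖p k‖) ^ N)⁻¹ :=
    hsum.subtype _
  refine ⟨ofAtoms c' _ N hsum', isPurePoint_ofAtoms .., ?_, fun φ => ?_⟩
  · rw [atoms_ofAtoms, hc', Set.image_univ, ← Function.comp_def p, Set.range_comp,
      Subtype.range_coe]
  · rw [toDistribution_ofAtoms_apply hsum' hp.injective]
    exact tsum_subtype_eq_of_support_subset (f := fun k => c k * φ (p k))
      fun k hk => left_ne_zero_of_mul hk

end SIMeasure

section Compactness

variable {ι : Type*}

theorem exists_tendsto_ultrafilter_of_isCompact {l : Ultrafilter ι} {X : Type*}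
    [TopologicalSpace X] {K : Set X} (hK : IsCompact K) {f : ι → X} (hf : ∀ j, f j ∈ K) :
    ∃ x ∈ K, Tendsto f l (𝓝 x) :=
  hK.ultrafilter_le_nhds' (l.map f) (Ultrafilter.mem_map.2 (univ_mem' hf))

theorem SIMeasure.injOn_support_of_tendsto {l : Filter ι} [l.NeBot] {n : ℕ}
    {m : ι → SIMeasure n} {δ : ℝ} (hδ : 0 < δ) (hsep : ∀ j, (m j).atoms.Pairwise (δ ≤ dist · ·))
    {κ : Type*} {p : ι → κ → Eucl n} (hinj : ∀ j, (p j).Injective) {c : κ → ℂ} {P : κ → Eucl n}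
    (hc : ∀ k, Tendsto (fun j => (m j).mass {p j k}) l (𝓝 (c k)))
    (hP : ∀ k, Tendsto (p · k) l (𝓝 (P k))) : (Function.support c).InjOn P := by
  intro k hk k' hk' hPk
  by_contra hne
  have hle : δ ≤ dist (P k) (P k') := by
    refine ge_of_tendsto ((hP k).dist (hP k')) ?_
    filter_upwards [(hc k).eventually_ne hk, (hc k').eventually_ne hk'] with j hj hj'
    exact hsep j hj hj' ((hinj j).ne hne)
  exact hle.not_gt (by rwa [hPk, dist_self])

theorem SIMeasure.exists_isPurePoint_tendsto_ultrafilter {l : Ultrafilter ι} {n : ℕ}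
    {m : ι → SIMeasure n} (hm : ∀ j, (m j).IsPurePoint)
    {M : ℝ} (hM : ∀ j x, ‖(m j).mass {x}‖ ≤ M) {δ : ℝ} (hδ : 0 < δ)
    (hsep : ∀ j, (m j).atoms.Pairwise (δ ≤ dist · ·)) :
    ∃ μ : SIMeasure n, μ.IsPurePoint ∧ μ.atoms ⊆ lowerLimit l (fun j => (m j).atoms) ∧
      Tendsto (fun j => (m j).toDistribution) l (𝓝 μ.toDistribution) := by
  obtain ⟨L, _, _, hL⟩ := exists_isZLattice_forall_pairwise_le_dist (Eucl n) hδ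
  choose p hinj hatoms hdist using fun j => hL _ (hsep j)
  choose c hcM hc using fun z : L =>
    exists_tendsto_ultrafilter_of_isCompact (l := l) (isCompact_closedBall (0 : ℂ) M)
      (f := fun j => (m j).mass {p j z}) fun j => mem_closedBall_zero_iff.2 (hM j _)
  choose P hPdist hP using fun z : L =>
    exists_tendsto_ultrafilter_of_isCompact (l := l) (isCompact_closedBall (z : Eucl n) δ)
      (f := (p · z)) fun j => Metric.mem_closedBall.2 (hdist j z)
  have hL_summable := summable_inv_one_add_norm_pow L
  obtain ⟨μ, hμ, hμ_atoms, hμ_apply⟩ := exists_isPurePoint_atoms_eq_image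
    (summable_norm_mul_inv_one_add_norm_pow_of_dist_le hL_summable
      (fun z => mem_closedBall_zero_iff.1 (hcM z)) hPdist)
    (injOn_support_of_tendsto hδ hsep hinj hc hP)
  refine ⟨μ, hμ, ?_, PointwiseConvergenceCLM.tendsto_iff_forall_tendsto.2 fun φ => ?_⟩
  · rw [hμ_atoms]
    rintro _ ⟨z, hz, rfl⟩
    exact ⟨(p · z), hP z, (hc z).eventually_ne hz⟩
  · simp only [hμ_apply, toDistribution_apply_eq_tsum (hm _) (hinj _) (hatoms _)]
    exact tendsto_tsum_mul_schwartzMap hL_summable (fun j z => hM j _) hdist hc hP φ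

end Compactness

end

theorem mainTheorem10 (n : ℕ) (μ ν : SIMeasure n)
    (hμ : μ.IsPurePoint) (hΛ : IsUniformlyDiscrete μ.atoms)
    (hν : 𝓕 μ.toDistribution = ν.toDistribution) :
    ∃ μ' : SIMeasure n,
      𝓕 μ'.toDistribution = ν.discretePart.toDistribution ∧
      (∃ τ : ℕ → Eucl n, Filter.Tendsto (fun j => (μ.translate (τ j)).toDistribution)
        Filter.atTop (𝓝 μ'.toDistribution)) ∧
      μ'.IsPurePoint ∧
      IsUniformlyDiscrete μ'.atoms ∧
      (IsUniformlyDiscrete (μ.atoms - μ.atoms) →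
        IsUniformlyDiscrete (μ'.atoms - μ'.atoms)) := by
  obtain ⟨M, hM⟩ := SIMeasure.exists_norm_mass_singleton_le hμ hΛ hν
  obtain ⟨τ, hτ⟩ := SIMeasure.exists_seq_tendsto_toDistribution_translate hν
  obtain ⟨δ, hδ, hsep⟩ := hΛ
  have hsep_translate (j : ℕ) : (μ.translate (τ j)).atoms.Pairwise (δ ≤ dist · ·) := by
    rw [SIMeasure.atoms_translate]
    intro x hx y hy hxy
    simpa using hsep _ hx _ hy ((add_left_injective (τ j)).ne hxy)
  obtain ⟨μ', hμ', hatoms, hlim⟩ := SIMeasure.exists_isPurePoint_tendsto_ultrafilter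
    (l := Filter.hyperfilter ℕ) (fun j => hμ.translate (τ j))
    (fun j x => (SIMeasure.mass_translate_singleton μ (τ j) x).symm ▸ hM _) hδ hsep_translate
  have hfourier : μ'.toDistribution = 𝓕⁻ ν.discretePart.toDistribution :=
    tendsto_nhds_unique hlim (hτ.mono_left Nat.hyperfilter_le_atTop)
  refine ⟨μ', ?_, ⟨τ, hfourier ▸ hτ⟩, hμ', ⟨δ, hδ, ?_⟩, fun ⟨ε, hε, hdiff⟩ => ⟨ε, hε, ?_⟩⟩
  · rw [hfourier, FourierTransform.fourier_fourierInv_eq]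
  · exact (pairwise_le_dist_lowerLimit hsep_translate).mono hatoms
  · refine Set.Pairwise.mono ((Set.sub_subset_sub hatoms hatoms).trans
      (lowerLimit_sub_lowerLimit_subset _ _)) (pairwise_le_dist_lowerLimit fun j => ?_)
    rwa [SIMeasure.atoms_translate, preimage_add_right_sub_preimage_add_right]
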